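/- For an integer $p\ge 2$, let $G_{2p}$ be the graph whose vertices are the ordered pairs $(i,j)$ of distinct elements of $\{0,1,\dots,p+1\}$, where $(i,j)$ is adjacent to $(k,\ell)$ if and only if ($k=j$ and $\ell\notin\{i,j\}$) or ($k\notin\{i,j\}$ and $\ell=i$). For an edge $vw$ of a graph $H$ and an integer $t\ge 1$, the cyclic chain of $t$ copies of $H-vw$ is the graph obtained from disjoint copies $H^{(s)}$ of $H-vw$ $(s\in\mathbb{Z}/t\mathbb{Z})$ by adding, for each $s$, an edge joining the copy $v^{(s)}$ of $v$ in $H^{(s)}$ to the copy $w^{(s+1)}$ of $w$ in $H^{(s+1)}$. A proper colouring of a graph with $k$ colours is a $k$-star colouring if, for every two colours, each connected component of the subgraph induced by the vertices of these two colours is a star (a single vertex counts as a star). A locally bijective homomorphism from $G$ to $H$ is a map $f\colon V(G)\to V(H)$ that sends edges to edges and such that, for every vertex $x$ of $G$ and every neighbour $b$ of $f(x)$ in $H$, exactly one neighbour $y$ of $x$ satisfies $f(y)=b$. **Theorem.** Let $p\ge 2$, and let $n$ be a positive integer divisible by $(p+1)(p+2)$; put $t=n/((p+1)(p+2))$. Then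 there exists a $2p$-regular Hamiltonian graph $G$ on $n$ vertices that has a $(p+2)$-star colouring. Moreover, $G$ can be taken to be, for a suitable edge $vw$ of $G_{2p}$, the cyclic chain of $t$ copies of $G_{2p}-vw$, such that the map sending every copy $u^{(s)}$ of a vertex $u$ of $G_{2p}$ to $u$ is a locally bijective homomorphism from $G$ to $G_{2p}$; and if $p=2$, then $G$ can in addition be taken to be planar. -/

import Mathlib

namespace StarCol

/-- A proper `k`-colouring `f` of `G` is a star colouring if every bicoloured component, that is,
every connected component of the subgraph induced by the union of two colour classes, is a star
(a star `K_{1,q}` with `q ≥ 0`; a single vertex counts as a star). -/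
def IsStarColouring {V : Type*} (G : SimpleGraph V) {k : ℕ} (f : G.Coloring (Fin k)) : Prop :=
  ∀ i j : Fin k, i ≠ j →
    ∀ C : (G.induce {x | f x = i ∨ f x = j}).ConnectedComponent,
      ∃ c : C, C.toSimpleGraph = SimpleGraph.starGraph c

/-- `G` is `k`-star colourable. -/
def StarColourable {V : Type*} (G : SimpleGraph V) (k : ℕ) : Prop :=
  ∃ f : G.Coloring (Fin k), IsStarColouring G f

/-- A drawing of `G` in the plane without crossings: vertices are distinct points, each edge is a
simple arc joining its two endpoints, an arc contains no vertex other than its endpoints, and two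
distinct arcs meet only in common endpoints. The values of `arc` off the edge set are irrelevant. -/
structure PlaneDrawing {V : Type*} (G : SimpleGraph V) where
  point : V → ℝ × ℝ
  point_injective : Function.Injective point
  arc : Sym2 V → Set (ℝ × ℝ)
  isArc : ∀ u v : V, G.Adj u v →
    ∃ γ : Path (point u) (point v), Function.Injective γ ∧ Set.range γ = arc s(u, v)
  vertex_mem : ∀ e ∈ G.edgeSet, ∀ x : V, point x ∈ arc e → x ∈ e
  arc_inter : ∀ e ∈ G.edgeSet, ∀ e' ∈ G.edgeSet, e ≠ e' →
    ∀ z ∈ arc e ∩ arc e', ∃ x : V, x ∈ e ∧ x ∈ e' ∧ point x = z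

/-- A graph is planar if it can be drawn in the plane without crossings. -/
def IsPlanar {V : Type*} (G : SimpleGraph V) : Prop := Nonempty (PlaneDrawing G)

/-- The vertices of `G_{2p}`: ordered pairs of distinct elements of `{0, 1, …, p + 1}`. -/
abbrev GVertex (p : ℕ) : Type := {x : Fin (p + 2) × Fin (p + 2) // x.1 ≠ x.2}

/-- The graph `G_{2p}`: the vertex `(i, j)` is adjacent to `(k, l)` if `k = j` and `l ∉ {i, j}`, or
`k ∉ {i, j}` and `l = i`. -/
def graphG (p : ℕ) : SimpleGraph (GVertex p) where
  Adj x y :=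
    (y.1.1 = x.1.2 ∧ y.1.2 ≠ x.1.1 ∧ y.1.2 ≠ x.1.2) ∨
    ((y.1.1 ≠ x.1.1 ∧ y.1.1 ≠ x.1.2) ∧ y.1.2 = x.1.1)
  symm := ⟨by
    rintro ⟨⟨i, j⟩, hx⟩ ⟨⟨k, l⟩, hy⟩ h
    dsimp only at *
    grind⟩
  loopless := ⟨by
    rintro ⟨⟨i, j⟩, hx⟩ h
    dsimp only at *
    grind⟩

/-- The cyclic chain of `t ≥ 1` copies of `H - vw`: take copies of `H` with the edge `vw` deleted,
indexed by `s ∈ ℤ/tℤ`, and for each `s` join the `s`-th copy of `v` to the `(s+1)`-th copy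
of `w`. -/
def cyclicChain {W : Type*} (H : SimpleGraph W) (v w : W) (t : ℕ) : SimpleGraph (ZMod t × W) :=
  SimpleGraph.fromRel fun a b =>
    (a.1 = b.1 ∧ (H.deleteEdges {s(v, w)}).Adj a.2 b.2) ∨ (b.1 = a.1 + 1 ∧ a.2 = v ∧ b.2 = w)

/-- A labelling `f` of the vertices of `G` by vertices of `H` is a locally bijective homomorphism
(`G` is an `H`-cover) if edges go to edges, and each vertex labelled `f x` has exactly one neighbour
labelled `b` for every neighbour `b` of `f x` in `H`. -/
def IsLocallyBijective {V W : Type*} (G : SimpleGraph V) (H : SimpleGraph W) (f : V → W) : Prop :=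
  (∀ x y, G.Adj x y → H.Adj (f x) (f y)) ∧
    ∀ x b, H.Adj (f x) b → ∃! y, G.Adj x y ∧ f y = b

end StarCol

/-! A cover of `graphG p` inherits both its degree `2 * p` and a star colouring: colour each vertex
by the first coordinate of its label. For colours `i ≠ j`, the vertices labelled `(i, j)` or `(j,
i)` are the centres. A vertex labelled `(i, a)` with `a ∉ {i, j}` has exactly one neighbour of
colour `j`, the one labelled `(j, i)`; so it is a leaf (`starColourable_of_isLocallyBijective`). The
cyclic chain is a cover, since each deleted edge is replaced, at both of its ends, by a link with
the same labels (`isLocallyBijective_cyclicChain`).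

For Hamiltonicity it is enough to have a Hamiltonian path of `graphG p` from `w = (p + 1, 0)` to `v
= (0, 1)`: its copies are strung together by the links. `exists_pair_list` builds this path by
induction on the number of symbols, prefixing a path through all pairs that contain the new symbol.

For `p = 2`, the graph without `vw` has an explicit straight-line drawing in the upper half-plane,
with only `v` and `w` on the axis. Copies stand side by side, links run along the axis, and the
closing link passes below it (`isPlanar_chainGraph`). -/

namespace StarCol

open SimpleGraph

/-! ### Covers: star colourings, degrees, and the cyclic chain as a cover -/

section Covers

/-- If the vertices of a graph split into centres and leaves so that every edge joins a centre to a
leaf and every leaf has at most one neighbour, then every component is a star. -/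
lemma exists_toSimpleGraph_eq_starGraph {V : Type*} {G : SimpleGraph V} (Z : Set V)
    (hZ : ∀ x y, G.Adj x y → (x ∈ Z ↔ y ∉ Z))
    (hleaf : ∀ x y z, x ∉ Z → G.Adj x y → G.Adj x z → y = z) (C : G.ConnectedComponent) :
    ∃ c : C, C.toSimpleGraph = starGraph c := by
  -- The second alternative covers a component consisting of one isolated leaf, which has no vertex
  -- in `Z`.
  obtain ⟨c, hcC, hc⟩ : ∃ c ∈ C.supp, c ∈ Z ∨ ∀ y, ¬ G.Adj c y := by
    obtain ⟨c, hc⟩ := C.nonempty_supp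
    by_cases h : ∃ y, G.Adj c y
    · obtain ⟨y, hy⟩ := h
      by_cases hcZ : c ∈ Z
      · exact ⟨c, hc, Or.inl hcZ⟩
      · refine ⟨y, C.mem_supp_of_adj_mem_supp hc hy, Or.inl ?_⟩
        by_contra hyZ
        exact hcZ ((hZ c y hy).2 hyZ)
    · exact ⟨c, hc, Or.inr (not_exists.1 h)⟩
  have key : ∀ x ∈ C.supp, x = c ∨ G.Adj c x := by
    intro x hx
    have hr : G.Reachable c x := C.reachable_of_mem_supp hcC hx
    rw [reachable_iff_reflTransGen] at hr
    clear hx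
    induction hr with
    | refl => exact Or.inl rfl
    | @tail a b _ hab ih =>
      rcases ih with rfl | ih
      · exact Or.inr hab
      · rcases hc with hc | hc
        · exact Or.inl (hleaf a b c ((hZ c a ih).1 hc) hab ih.symm)
        · exact absurd ih (hc a)
  refine ⟨⟨c, hcC⟩, ?_⟩
  ext ⟨x, hx⟩ ⟨y, hy⟩
  rw [starGraph_adj, ConnectedComponent.toSimpleGraph_adj]
  simp only [ne_eq, Subtype.mk.injEq]
  constructor
  · intro h
    refine ⟨h.ne, ?_⟩
    by_contra! hne
    have hx' := (key x hx).resolve_left hne.1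
    have hy' := (key y hy).resolve_left hne.2
    have hcZ : c ∈ Z := hc.resolve_right fun h => h x hx'
    exact (hZ c x hx').1 hcZ ((hZ x y h).2 ((hZ c y hy').1 hcZ))
  · rintro ⟨hne, rfl | rfl⟩
    · exact (key y hy).resolve_left fun h => hne h.symm
    · exact ((key x hx).resolve_left hne).symm

/-- A cover of `G_{2p}` is coloured by the first coordinates of the labels. -/
lemma starColourable_of_isLocallyBijective {V : Type*} {G : SimpleGraph V} {p : ℕ}
    {g : V → GVertex p} (hg : IsLocallyBijective G (graphG p) g) : StarColourable G (p + 2) := by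
  have hne : ∀ x, (g x).1.1 ≠ (g x).1.2 := fun x => (g x).2
  have hadj : ∀ x y, G.Adj x y →
      ((g y).1.1 = (g x).1.2 ∧ (g y).1.2 ≠ (g x).1.1 ∧ (g y).1.2 ≠ (g x).1.2) ∨
      (((g y).1.1 ≠ (g x).1.1 ∧ (g y).1.1 ≠ (g x).1.2) ∧ (g y).1.2 = (g x).1.1) := hg.1
  refine ⟨Coloring.mk (fun x => (g x).1.1) ?_, ?_⟩
  · intro x y hxy
    have := hadj x y hxy
    have := hne x
    grind
  · intro i j hij C
    -- The centres are the vertices labelled `(i, j)` or `(j, i)`, the first coordinate being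
    -- already `i` or `j`.
    refine exists_toSimpleGraph_eq_starGraph {x | (g x.1).1.2 = i ∨ (g x.1).1.2 = j} ?_ ?_ C
    · rintro ⟨x, hx⟩ ⟨y, hy⟩ hxy
      have := hadj x y hxy
      have := hne x
      have := hne y
      have hx' : (g x).1.1 = i ∨ (g x).1.1 = j := hx
      have hy' : (g y).1.1 = i ∨ (g y).1.1 = j := hy
      simp only [Set.mem_ofPred_eq]
      grind
    · rintro ⟨x, hx⟩ ⟨y, hy⟩ ⟨z, hz⟩ hxZ hxy hxz
      have h1 := hadj x y hxy
      have h2 := hadj x z hxz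
      have := hne x
      have hx' : (g x).1.1 = i ∨ (g x).1.1 = j := hx
      have hy' : (g y).1.1 = i ∨ (g y).1.1 = j := hy
      have hz' : (g z).1.1 = i ∨ (g z).1.1 = j := hz
      simp only [Set.mem_ofPred_eq] at hxZ
      have hyz : g y = g z := Subtype.ext (Prod.ext (by grind) (by grind))
      exact Subtype.ext ((hg.2 x (g z) (hg.1 x z hxz)).unique ⟨hxy, hyz⟩ ⟨hxz, rfl⟩)

lemma IsLocallyBijective.degree_eq {V W : Type*} {G : SimpleGraph V} {H : SimpleGraph W}
    {f : V → W} (hf : IsLocallyBijective G H f) (x : V) [Fintype (G.neighborSet x)]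
    [Fintype (H.neighborSet (f x))] :
    G.degree x = H.degree (f x) := by
  rw [← card_neighborFinset_eq_degree, ← card_neighborFinset_eq_degree]
  refine Finset.card_bij (fun y _ => f y) ?_ ?_ ?_
  · intro y hy
    rw [mem_neighborFinset] at hy ⊢
    exact hf.1 x y hy
  · intro y hy z hz hyz
    rw [mem_neighborFinset] at hy hz
    exact (hf.2 x (f z) (hf.1 x z hz)).unique ⟨hy, hyz⟩ ⟨hz, rfl⟩
  · intro b hb
    rw [mem_neighborFinset] at hb
    obtain ⟨y, ⟨hy, hyb⟩, -⟩ := hf.2 x b hb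
    exact ⟨y, by rwa [mem_neighborFinset], hyb⟩

lemma IsLocallyBijective.comp_iso {V V' W : Type*} {G : SimpleGraph V} {G' : SimpleGraph V'}
    {H : SimpleGraph W} {f : V' → W} (hf : IsLocallyBijective G' H f) (e : G ≃g G') :
    IsLocallyBijective G H (fun x => f (e x)) := by
  refine ⟨fun x y h => hf.1 _ _ (e.map_adj_iff.2 h), fun x b hb => ?_⟩
  obtain ⟨y, ⟨hy, hyb⟩, huniq⟩ := hf.2 (e x) b hb
  refine ⟨e.symm y, ⟨?_, by simpa using hyb⟩, fun z hz => ?_⟩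
  · rw [← e.map_adj_iff]
    simpa using hy
  · rw [← huniq (e z) ⟨e.map_adj_iff.2 hz.1, hz.2⟩]
    simp

instance (p : ℕ) : DecidableRel (graphG p).Adj := fun _ _ => instDecidableOr

lemma graphG_degree (p : ℕ) (x : GVertex p) : (graphG p).degree x = 2 * p := by
  obtain ⟨⟨i, j⟩, hij⟩ := x
  have hij' : i ≠ j := hij
  have hcard : (Finset.univ.filter fun l : Fin (p + 2) => l ≠ i ∧ l ≠ j).card = p := by
    have : (Finset.univ.filter fun l : Fin (p + 2) => l ≠ i ∧ l ≠ j) = {i, j}ᶜ := by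
      ext l
      simp
    rw [this, Finset.card_compl, Finset.card_pair hij', Fintype.card_fin]
    lia
  have h : (graphG p).neighborFinset ⟨(i, j), hij⟩ =
      (Finset.univ.filter fun y : GVertex p => y.1.1 = j ∧ y.1.2 ≠ i ∧ y.1.2 ≠ j) ∪
      (Finset.univ.filter fun y : GVertex p => (y.1.1 ≠ i ∧ y.1.1 ≠ j) ∧ y.1.2 = i) := by
    ext y
    rw [mem_neighborFinset, Finset.mem_union, Finset.mem_filter, Finset.mem_filter]
    simp [graphG]
  rw [← card_neighborFinset_eq_degree, h, Finset.card_union_of_disjoint, two_mul]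
  · congr 1
    · refine Eq.trans ?_ hcard
      refine Finset.card_bij (fun y _ => y.1.2) (by simp) ?_ ?_
      · rintro ⟨⟨a, b⟩, h⟩ h1 ⟨⟨c, d⟩, h'⟩ h2 h3
        simp_all
      · intro l hl
        simp only [Finset.mem_filter, Finset.mem_univ, true_and] at hl
        exact ⟨⟨(j, l), hl.2.symm⟩, by simpa using hl, rfl⟩
    · refine Eq.trans ?_ hcard
      refine Finset.card_bij (fun y _ => y.1.1) (by simp +contextual) ?_ ?_
      · rintro ⟨⟨a, b⟩, h⟩ h1 ⟨⟨c, d⟩, h'⟩ h2 h3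
        simp_all
      · intro l hl
        simp only [Finset.mem_filter, Finset.mem_univ, true_and] at hl
        exact ⟨⟨(l, i), hl.1⟩, by simpa using hl, rfl⟩
  · rw [Finset.disjoint_filter]
    rintro y - h1 h2
    exact h2.1.2 h1.1

lemma cyclicChain_adj {W : Type*} {H : SimpleGraph W} {v w : W} (hvw : v ≠ w) {t : ℕ}
    {a b : ZMod t × W} : (cyclicChain H v w t).Adj a b ↔
      (a.1 = b.1 ∧ H.Adj a.2 b.2 ∧ s(a.2, b.2) ≠ s(v, w)) ∨
      (b.1 = a.1 + 1 ∧ a.2 = v ∧ b.2 = w) ∨ (a.1 = b.1 + 1 ∧ a.2 = w ∧ b.2 = v) := by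
  obtain ⟨s, x⟩ := a
  obtain ⟨r, y⟩ := b
  simp only [cyclicChain, fromRel_adj, deleteEdges_adj, Set.mem_singleton_iff, ne_eq,
    Prod.mk.injEq, not_and]
  rw [H.adj_comm y x, Sym2.eq_swap (a := y)]
  constructor
  · grind
  · rintro (h | h | h)
    · have := h.2.1.ne
      grind
    · grind
    · grind

/-- Only the copies of `v` and `w` lose a neighbour; the link to the next or previous copy gives
back exactly one with the missing label. For `t = 1` the link restores the edge `vw` itself. -/
lemma isLocallyBijective_cyclicChain {W : Type*} {H : SimpleGraph W} {v w : W} (hvw : H.Adj v w)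
    (t : ℕ) : IsLocallyBijective (cyclicChain H v w t) H Prod.snd := by
  have hne := hvw.ne
  constructor
  · rintro ⟨s, x⟩ ⟨r, y⟩ h
    rw [cyclicChain_adj hne] at h
    rcases h with h | ⟨-, rfl, rfl⟩ | ⟨-, rfl, rfl⟩
    exacts [h.2.1, hvw, hvw.symm]
  · rintro ⟨s, x⟩ b (hb : H.Adj x b)
    simp only [cyclicChain_adj hne]
    by_cases h : s(x, b) = s(v, w)
    · rcases Sym2.eq_iff.1 h with ⟨rfl, rfl⟩ | ⟨rfl, rfl⟩
      · refine ⟨(s + 1, b), by simp, ?_⟩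
        rintro ⟨r, y⟩ ⟨hy, rfl⟩
        grind
      · refine ⟨(s - 1, b), by simp, ?_⟩
        rintro ⟨r, y⟩ ⟨hy, rfl⟩
        have : s = r + 1 := by grind
        simp [this]
    · refine ⟨(s, b), by simp [hb, h], ?_⟩
      rintro ⟨r, y⟩ ⟨hy, rfl⟩
      rw [Sym2.eq_iff] at h
      grind

end Covers

end StarCol

namespace StarCol

open SimpleGraph

/-! ### Hamiltonian cycles of the chain and Hamiltonian paths of `graphG p` -/

section Hamilton

/-- A list which lists every vertex once, and which follows the edges of the graph and closes up. -/
lemma isHamiltonian_of_list {V : Type*} [Fintype V] [DecidableEq V] {G : SimpleGraph V}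
    {l : List V} {a b : V} (hchain : l.IsChain G.Adj) (hnd : l.Nodup) (hmem : ∀ x, x ∈ l)
    (ha : l.head? = some a) (hb : l.getLast? = some b) (hba : G.Adj b a) (hlen : 3 ≤ l.length) :
    G.IsHamiltonian := by
  intro _
  have hne : l ≠ [] := by
    rintro rfl
    simp at hlen
  obtain rfl : l.head hne = a := by simpa [List.head?_eq_some_head hne] using ha
  obtain rfl : l.getLast hne = b := by simpa [List.getLast?_eq_some_getLast hne] using hb
  set q := Walk.ofSupport l hne hchain with hq
  have hpath : q.IsPath := by
    rw [Walk.isPath_def, hq, Walk.support_ofSupport]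
    exact hnd
  have hham : q.IsHamiltonian := hpath.isHamiltonian_of_mem fun x => by
    rw [hq, Walk.support_ofSupport]
    exact hmem x
  refine ⟨_, Walk.cons hba q, ⟨?_, ?_⟩⟩
  · rw [Walk.cons_isCycle_iff]
    refine ⟨hpath, fun hmem => ?_⟩
    -- A path using an edge between its own ends has length one, but `q` has at least three
    -- vertices.
    have h1 : q.length = 1 := by
      rw [Sym2.eq_swap] at hmem
      exact hpath.length_eq_one_of_mem_edges hmem
    rw [hq, Walk.length_ofSupport] at h1
    lia
  · intro x
    rw [Walk.support_tail_of_not_nil _ Walk.not_nil_cons]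
    exact hham x

lemma isHamiltonian_of_iso {V W : Type*} [Fintype V] [Fintype W] [DecidableEq V] [DecidableEq W]
    {G : SimpleGraph V} {H : SimpleGraph W} (e : G ≃g H) (hG : G.IsHamiltonian) :
    H.IsHamiltonian := by
  intro hH
  obtain ⟨a, q, hq⟩ := hG (by rwa [Fintype.card_congr e.toEquiv])
  exact ⟨_, q.map e.toHom, hq.map e.bijective⟩

/-- Concatenating lists that follow a relation. -/
lemma isChain_flatMap_range {α : Type*} {R : α → α → Prop} (f : ℕ → List α) (a b : ℕ → α) (n : ℕ)
    (hf : ∀ i ≤ n, (f i).IsChain R) (ha : ∀ i ≤ n, (f i).head? = some (a i))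
    (hb : ∀ i ≤ n, (f i).getLast? = some (b i)) (hR : ∀ i < n, R (b i) (a (i + 1))) :
    ((List.range (n + 1)).flatMap f).IsChain R ∧
      ((List.range (n + 1)).flatMap f).head? = some (a 0) ∧
      ((List.range (n + 1)).flatMap f).getLast? = some (b n) := by
  induction n with
  | zero => simpa using ⟨hf 0 le_rfl, ha 0 le_rfl, hb 0 le_rfl⟩
  | succ n ih =>
    obtain ⟨h1, h2, h3⟩ := ih (fun i hi => hf i (by lia)) (fun i hi => ha i (by lia))
      (fun i hi => hb i (by lia)) (fun i hi => hR i (by lia))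
    rw [List.range_succ, List.flatMap_append, List.flatMap_singleton]
    refine ⟨List.isChain_append.2 ⟨h1, hf _ le_rfl, ?_⟩, ?_, ?_⟩
    · rw [h3, ha _ le_rfl]
      rintro x hx y hy
      obtain rfl : b n = x := by simpa using hx
      obtain rfl : a (n + 1) = y := by simpa using hy
      exact hR n (by lia)
    · rw [List.head?_append, h2]
      rfl
    · rw [List.getLast?_append, hb _ le_rfl]
      rfl

/-- A path through the whole vertex set does not use the edge joining its ends. -/
lemma isChain_deleteEdges {V : Type*} {G : SimpleGraph V} {l : List V} {a b : V}
    (hchain : l.IsChain G.Adj) (hnd : l.Nodup) (ha : l.head? = some a) (hb : l.getLast? = some b)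
    (hlen : 3 ≤ l.length) : l.IsChain (G.deleteEdges {s(b, a)}).Adj := by
  rw [List.isChain_iff_getElem] at hchain ⊢
  intro i hi
  rw [deleteEdges_adj, Set.mem_singleton_iff]
  refine ⟨hchain i hi, fun h => ?_⟩
  have ha' : l[0] = a := by
    rw [List.head?_eq_getElem?, List.getElem?_eq_getElem (by lia)] at ha
    exact Option.some.inj ha
  have hb' : l[l.length - 1] = b := by
    rw [List.getLast?_eq_getElem?, List.getElem?_eq_getElem (by lia)] at hb
    exact Option.some.inj hb
  rw [← ha', ← hb', Sym2.eq_iff, hnd.getElem_inj_iff, hnd.getElem_inj_iff, hnd.getElem_inj_iff,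
    hnd.getElem_inj_iff] at h
  lia

/-- A Hamiltonian path of `H` from `w` to `v` closes up to a Hamiltonian cycle of the chain. -/
lemma isHamiltonian_cyclicChain {W : Type*} [Fintype W] [DecidableEq W] {H : SimpleGraph W}
    {v w : W} (hvw : H.Adj v w) {l : List W} (hchain : l.IsChain H.Adj) (hnd : l.Nodup)
    (hmem : ∀ x, x ∈ l) (hw : l.head? = some w) (hv : l.getLast? = some v) (hlen : 3 ≤ l.length)
    (t : ℕ) [NeZero t] : (cyclicChain H v w t).IsHamiltonian := by
  obtain ⟨n, rfl⟩ := Nat.exists_eq_succ_of_ne_zero (NeZero.ne t)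
  have hne := hvw.ne
  set f : ℕ → List (ZMod (n + 1) × W) := fun s => l.map fun u => ((s : ZMod (n + 1)), u) with hf
  obtain ⟨h1, h2, h3⟩ := isChain_flatMap_range (R := (cyclicChain H v w (n + 1)).Adj) f
    (fun s => (s, w)) (fun s => (s, v)) n
    (fun s _ => by
      rw [hf, List.isChain_map]
      refine (isChain_deleteEdges hchain hnd hw hv hlen).imp fun x y hxy => ?_
      rw [deleteEdges_adj] at hxy
      rw [cyclicChain_adj hne]
      exact Or.inl ⟨rfl, hxy.1, hxy.2⟩)
    (fun s _ => by simp [hf, hw]) (fun s _ => by simp [hf, hv])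
    (fun s _ => by
      rw [cyclicChain_adj hne]
      exact Or.inr (Or.inl ⟨by simp, rfl, rfl⟩))
  refine isHamiltonian_of_list h1 ?_ ?_ h2 h3 ?_ ?_
  · rw [List.nodup_flatMap]
    refine ⟨fun s _ => hnd.map fun x y hxy => (Prod.mk.inj hxy).2, ?_⟩
    refine List.nodup_range.imp_of_mem ?_
    intro s r hs hr hsr
    rw [List.mem_range] at hs hr
    rw [Function.onFun, List.disjoint_left]
    intro x hx hx'
    simp only [hf, List.mem_map] at hx hx'
    obtain ⟨u, -, rfl⟩ := hx
    obtain ⟨u', -, h⟩ := hx'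
    have := congrArg ZMod.val (Prod.mk.inj h).1
    rw [ZMod.val_natCast_of_lt hs, ZMod.val_natCast_of_lt hr] at this
    exact hsr this.symm
  · rintro ⟨s, u⟩
    rw [List.mem_flatMap]
    exact ⟨s.val, List.mem_range.2 (ZMod.val_lt s), List.mem_map.2 ⟨u, hmem u, by simp⟩⟩
  · rw [cyclicChain_adj hne]
    refine Or.inr (Or.inl ⟨?_, rfl, rfl⟩)
    -- The closing edge leaves copy `n` and enters copy `0`, as `n + 1 = 0` in `ZMod (n + 1)`.
    have := ZMod.natCast_self (n + 1)
    push_cast at this ⊢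
    exact this.symm
  · rw [List.range_succ, List.flatMap_append, List.length_append, List.flatMap_singleton]
    have : (f n).length = l.length := by simp [hf]
    lia

/-- The adjacency of `G_{2p}`, for pairs of natural numbers. -/
def PairAdj (x y : ℕ × ℕ) : Prop :=
  (y.1 = x.2 ∧ y.2 ≠ x.1 ∧ y.2 ≠ x.2) ∨ ((y.1 ≠ x.1 ∧ y.1 ≠ x.2) ∧ y.2 = x.1)

instance : DecidableRel PairAdj := fun _ _ => instDecidableOr

/-- The permutation `i ↦ i + 2` of `{0, …, m - 1}`, with the last two values interchanged. -/
def crownShift (m i : ℕ) : ℕ := if i + 2 < m then i + 2 else if i + 2 = m then 1 else 0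

/-- A path from `(m, 0)` to `(0, m)` through the pairs `(m, i)` and `(i, m)` with `i < m`. -/
def crownPath (m : ℕ) : List (ℕ × ℕ) :=
  (List.range m).flatMap fun i => [(m, i), (crownShift m i, m)]

lemma mem_crownPath {m : ℕ} (hm : 4 ≤ m) (x : ℕ × ℕ) :
    x ∈ crownPath m ↔ (x.1 = m ∧ x.2 < m) ∨ (x.1 < m ∧ x.2 = m) := by
  obtain ⟨a, b⟩ := x
  simp only [crownPath, List.mem_flatMap, List.mem_range, List.mem_cons, List.not_mem_nil,
    or_false, Prod.mk.injEq]
  constructor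
  · rintro ⟨i, hi, ⟨rfl, rfl⟩ | ⟨rfl, rfl⟩⟩
    · exact Or.inl ⟨rfl, hi⟩
    · refine Or.inr ⟨?_, rfl⟩
      unfold crownShift
      split_ifs <;> lia
  · rintro (⟨rfl, hb⟩ | ⟨ha, rfl⟩)
    · exact ⟨b, hb, Or.inl ⟨rfl, rfl⟩⟩
    · refine ⟨if a = 0 then b - 1 else if a = 1 then b - 2 else a - 2, ?_, Or.inr ⟨?_, rfl⟩⟩
      · split_ifs <;> lia
      · unfold crownShift
        split_ifs <;> lia

lemma crownShift_inj {m i j : ℕ} (hi : i < m) (hj : j < m)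
    (h : crownShift m i = crownShift m j) : i = j := by
  unfold crownShift at h
  split_ifs at h <;> lia

lemma nodup_crownPath (m : ℕ) (hm : 4 ≤ m) : (crownPath m).Nodup := by
  rw [crownPath, List.nodup_flatMap]
  have hlt : ∀ i, crownShift m i ≠ m := fun i => by
    unfold crownShift
    split_ifs <;> lia
  refine ⟨fun i hi => ?_, ?_⟩
  · have := hlt i
    simp
    grind
  · refine List.nodup_range.imp_of_mem ?_
    intro i j hi hj hij
    rw [List.mem_range] at hi hj
    have := hlt i
    have := hlt j
    have := fun h => hij (crownShift_inj hi hj h)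
    simp [Function.onFun]
    grind

/-- The pair `(m, i)` is adjacent to `(k, m)` when `k ≠ i`, and `(k, m)` to `(m, i + 1)` when `k ≠ i
+ 1`. A cyclic shift by two avoids both values; interchanging its last two values keeps this for `m
≥ 4` and makes the path end at `(0, m)`. -/
lemma isChain_crownPath {m : ℕ} (hm : 4 ≤ m) : (crownPath m).IsChain PairAdj ∧
    (crownPath m).head? = some (m, 0) ∧ (crownPath m).getLast? = some (0, m) := by
  obtain ⟨n, rfl⟩ : ∃ n, m = n + 1 := ⟨m - 1, by lia⟩
  have h := isChain_flatMap_range (R := PairAdj)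
    (fun i => [(n + 1, i), (crownShift (n + 1) i, n + 1)]) (fun i => (n + 1, i))
    (fun i => (crownShift (n + 1) i, n + 1)) n ?_ (by simp) (by simp) ?_
  · have h0 : crownShift (n + 1) n = 0 := by
      unfold crownShift
      split_ifs <;> lia
    rwa [h0] at h
  · intro i hi
    simp only [List.isChain_cons_cons, List.isChain_singleton, and_true, PairAdj, crownShift]
    split_ifs <;> lia
  · intro i hi
    simp only [PairAdj, crownShift]
    split_ifs <;> lia

/-- The ends are chosen to make the induction work: the crown of the new symbol `m` runs from `(m,
0)`, the required new head, to `(0, m)`, which is adjacent to the old head `(m - 1, 0)`. The last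
pair never changes. -/
lemma exists_pair_list {m : ℕ} (hm : 4 ≤ m) : ∃ l : List (ℕ × ℕ), l.IsChain PairAdj ∧ l.Nodup ∧
    (∀ x, x ∈ l ↔ x.1 < m ∧ x.2 < m ∧ x.1 ≠ x.2) ∧ l.head? = some (m - 1, 0) ∧
    l.getLast? = some (0, 1) := by
  induction m, hm using Nat.le_induction with
  | base =>
    refine ⟨[(3, 0), (0, 2), (1, 0), (0, 3), (3, 1), (2, 3), (1, 2), (2, 0), (3, 2), (2, 1),
      (1, 3), (0, 1)], by decide, by decide, ?_, rfl, rfl⟩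
    rintro ⟨a, b⟩
    constructor
    · intro h
      simp only [List.mem_cons, Prod.mk.injEq, List.not_mem_nil, or_false] at h
      rcases h with h | h | h | h | h | h | h | h | h | h | h | h <;> simp [h.1, h.2]
    · rintro ⟨ha, hb, hab⟩
      dsimp only at ha hb hab
      interval_cases a <;> interval_cases b <;> simp_all
  | succ m hm ih =>
    obtain ⟨l, h1, h2, h3, h4, h5⟩ := ih
    obtain ⟨c1, c2, c3⟩ := isChain_crownPath hm
    refine ⟨crownPath m ++ l, List.isChain_append.2 ⟨c1, h1, ?_⟩,
      List.nodup_append'.2 ⟨nodup_crownPath m hm, h2, ?_⟩, ?_, ?_, ?_⟩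
    · rw [c3, h4]
      rintro x hx y hy
      obtain rfl : (0, m) = x := by simpa using hx
      obtain rfl : (m - 1, 0) = y := by simpa using hy
      simp only [PairAdj]
      lia
    · rw [List.disjoint_left]
      intro x hx hx'
      rw [mem_crownPath hm] at hx
      rw [h3] at hx'
      lia
    · intro x
      rw [List.mem_append, mem_crownPath hm, h3]
      lia
    · rw [List.head?_append, c2]
      rfl
    · rw [List.getLast?_append, h5]
      rfl

/-- The first end of the deleted edge. -/
def headVertex (p : ℕ) : GVertex p := ⟨(0, 1), by simp⟩

/-- The second end of the deleted edge. -/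
def tailVertex (p : ℕ) : GVertex p := ⟨(Fin.last (p + 1), 0), by simp [Fin.ext_iff]⟩

lemma headVertex_adj_tailVertex {p : ℕ} (hp : 1 ≤ p) :
    (graphG p).Adj (headVertex p) (tailVertex p) := by
  refine Or.inr ⟨?_, rfl⟩
  simp only [headVertex, tailVertex, ne_eq, Fin.ext_iff, Fin.val_last, Fin.val_zero, Fin.val_one]
  lia

lemma exists_hamiltonian_list {p : ℕ} (hp : 2 ≤ p) : ∃ l : List (GVertex p),
    l.IsChain (graphG p).Adj ∧ l.Nodup ∧ (∀ x, x ∈ l) ∧ l.head? = some (tailVertex p) ∧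
    l.getLast? = some (headVertex p) := by
  obtain ⟨l, h1, h2, h3, h4, h5⟩ := exists_pair_list (m := p + 2) (by lia)
  set φ : GVertex p → ℕ × ℕ := fun x => (x.1.1.val, x.1.2.val) with hφ
  have hinj : Function.Injective φ := by
    rintro ⟨⟨a, b⟩, h⟩ ⟨⟨c, d⟩, h'⟩ he
    simpa [hφ, Fin.ext_iff] using he
  obtain ⟨l, rfl⟩ : ∃ l', List.map φ l' = l := by
    rw [← Set.mem_range, Set.range_list_map]
    intro x hx
    obtain ⟨ha, hb, hab⟩ := (h3 x).1 hx
    exact ⟨⟨(⟨x.1, ha⟩, ⟨x.2, hb⟩), by simpa [Fin.ext_iff] using hab⟩, rfl⟩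
  refine ⟨l, ?_, List.Nodup.of_map _ h2, fun x => ?_, ?_, ?_⟩
  · rw [List.isChain_map] at h1
    refine h1.imp fun x y hxy => ?_
    simpa [PairAdj, graphG, hφ, Fin.ext_iff] using hxy
  · rw [← List.mem_map_of_injective hinj, h3]
    exact ⟨x.1.1.2, x.1.2.2, fun h => x.2 (Fin.ext h)⟩
  · rw [List.head?_map] at h4
    obtain ⟨x, hx, hx'⟩ := Option.map_eq_some_iff.1 h4
    rw [hx, Option.some.injEq]
    exact hinj (by rw [hx']; simp [hφ, tailVertex])
  · rw [List.getLast?_map] at h5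
    obtain ⟨x, hx, hx'⟩ := Option.map_eq_some_iff.1 h5
    rw [hx, Option.some.injEq]
    exact hinj (by rw [hx']; simp [hφ, headVertex])

end Hamilton

end StarCol

namespace StarCol

open SimpleGraph

/-! ### Segments in the plane and the explicit drawing of one copy -/

section Planar

/-- Twice the signed area of the triangle `abc`. -/
def cross {R : Type*} [Ring R] (a b c : R × R) : R :=
  (b.1 - a.1) * (c.2 - a.2) - (b.2 - a.2) * (c.1 - a.1)

lemma exists_of_mem_segment {a b z : ℝ × ℝ} (hz : z ∈ segment ℝ a b) :
    ∃ s r : ℝ, 0 ≤ s ∧ 0 ≤ r ∧ s + r = 1 ∧ z = (s * a.1 + r * b.1, s * a.2 + r * b.2) := by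
  obtain ⟨s, r, hs, hr, hsr, rfl⟩ := hz
  exact ⟨s, r, hs, hr, hsr, Prod.ext (by simp) (by simp)⟩

lemma cross_eq_zero_of_mem_segment {a b z : ℝ × ℝ} (hz : z ∈ segment ℝ a b) :
    cross a b z = 0 := by
  obtain ⟨s, r, -, -, hsr, rfl⟩ := exists_of_mem_segment hz
  obtain rfl : s = 1 - r := by linarith
  simp only [cross]
  ring

/-- As `cross a b` is affine in its third argument, a segment whose ends lie strictly on the same
side of the line `ab` misses that line. -/
lemma not_mem_segment_of_cross_mul_pos {a b c d z : ℝ × ℝ} (h : 0 < cross a b c * cross a b d)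
    (hz : z ∈ segment ℝ a b) : z ∉ segment ℝ c d := by
  intro hz'
  have h0 := cross_eq_zero_of_mem_segment hz
  obtain ⟨s, r, hs, hr, hsr, rfl⟩ := exists_of_mem_segment hz'
  have h1 : s * cross a b c + r * cross a b d = 0 := by
    rw [← h0]
    obtain rfl : s = 1 - r := by linarith
    simp only [cross]
    ring
  rcases hs.eq_or_lt with rfl | hs
  · obtain rfl : r = 1 := by linarith
    have : cross a b d = 0 := by linarith
    simp [this] at h
  · have h2 : 0 < s * (cross a b c * cross a b c) :=
      mul_pos hs (mul_self_pos.2 (left_ne_zero_of_mul h.ne'))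
    have h3 : 0 ≤ r * (cross a b c * cross a b d) := mul_nonneg hr h.le
    have : cross a b c * (s * cross a b c + r * cross a b d) = 0 := by rw [h1, mul_zero]
    linarith

lemma eq_of_mem_segment_of_cross_ne_zero {a b d z : ℝ × ℝ} (h : cross a b d ≠ 0)
    (hz : z ∈ segment ℝ a b) (hz' : z ∈ segment ℝ a d) : z = a := by
  have h0 := cross_eq_zero_of_mem_segment hz
  obtain ⟨s, r, hs, hr, hsr, rfl⟩ := exists_of_mem_segment hz'
  obtain rfl : s = 1 - r := by linarith
  have h1 : r * cross a b d = 0 := by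
    rw [← h0]
    simp only [cross]
    ring
  obtain rfl := (mul_eq_zero.1 h1).resolve_right h
  simp

lemma exists_path_range_eq_segment {a b : ℝ × ℝ} (hab : a ≠ b) :
    ∃ γ : Path a b, Function.Injective γ ∧ Set.range γ = segment ℝ a b := by
  refine ⟨⟨⟨fun r => AffineMap.lineMap a b (r : ℝ), ?_⟩, by simp, by simp⟩, ?_, ?_⟩
  · exact AffineMap.lineMap_continuous.comp continuous_subtype_val
  · exact (AffineMap.lineMap_injective ℝ hab).comp Subtype.val_injective
  · rw [segment_eq_image_lineMap]
    ext z
    constructor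
    · rintro ⟨r, rfl⟩
      exact ⟨r, r.2, rfl⟩
    · rintro ⟨r, hr, rfl⟩
      exact ⟨⟨r, hr⟩, rfl⟩

/-- The parabolic arc below the horizontal axis from `0` to `T`. -/
def lowerArc (T : ℝ) : Set (ℝ × ℝ) :=
  {z | ∃ r : ℝ, 0 ≤ r ∧ r ≤ 1 ∧ z = (T * r, -(r * (1 - r)))}

lemma exists_path_range_eq_lowerArc {T : ℝ} (hT : T ≠ 0) :
    ∃ γ : Path ((0, 0) : ℝ × ℝ) (T, 0), Function.Injective γ ∧ Set.range γ = lowerArc T := by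
  refine ⟨⟨⟨fun r => (T * (r : ℝ), -((r : ℝ) * (1 - r))), by fun_prop⟩, by simp, by simp⟩, ?_, ?_⟩
  · intro r s h
    exact Subtype.ext (mul_left_cancel₀ hT (Prod.mk.inj h).1)
  · ext z
    constructor
    · rintro ⟨r, rfl⟩
      exact ⟨r, r.2.1, r.2.2, rfl⟩
    · rintro ⟨r, h0, h1, rfl⟩
      exact ⟨⟨r, h0, h1⟩, rfl⟩

lemma eq_of_mem_lowerArc {T : ℝ} {z : ℝ × ℝ} (hz : z ∈ lowerArc T) (hz2 : 0 ≤ z.2) :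
    z = (0, 0) ∨ z = (T, 0) := by
  obtain ⟨r, h0, h1, rfl⟩ := hz
  have h : r * (1 - r) = 0 :=
    le_antisymm (by simpa using hz2) (mul_nonneg h0 (by linarith))
  rcases mul_eq_zero.1 h with rfl | h
  · simp
  · obtain rfl : r = 1 := by linarith
    simp

/-- A planar straight-line drawing of `G_4` without one edge of the outer face. -/
def pos (u : GVertex 2) : ℤ × ℤ :=
  -- Rows are first coordinates, columns second; the diagonal zeros belong to no vertex.
  ((![![0, 14, 4, 8], ![6, 0, 9, 7], ![10, 6, 0, 5], ![0, 7, 8, 0]] : Fin 4 → Fin 4 → ℤ) u.1.1 u.1.2,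
   (![![0, 0, 4, 5], ![5, 0, 3, 14], ![4, 9, 0, 3], ![0, 4, 9, 0]] : Fin 4 → Fin 4 → ℤ) u.1.1 u.1.2)

/-- The edges of `G_4` that are kept in the copies. -/
def InnerAdj (a b : GVertex 2) : Prop :=
  (graphG 2).Adj a b ∧ s(a, b) ≠ s(headVertex 2, tailVertex 2)

instance : DecidableRel InnerAdj := fun _ _ => instDecidableAnd

lemma pos_injective : Function.Injective pos := by
  unfold Function.Injective
  decide +kernel

lemma pos_bounds : ∀ u, 0 ≤ (pos u).1 ∧ (pos u).1 ≤ 14 ∧ 0 ≤ (pos u).2 ∧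
    ((pos u).2 = 0 → u = headVertex 2 ∨ u = tailVertex 2) := by
  decide +kernel

lemma pos_pos_of_innerAdj : ∀ a b, InnerAdj a b → 0 < (pos a).2 ∨ 0 < (pos b).2 := by
  decide +kernel

/-- General position: this keeps edges off other vertices and makes two edges with a common end meet
only there. -/
lemma cross_pos_ne_zero : ∀ a b, InnerAdj a b → ∀ d, d ≠ a → d ≠ b →
    cross (pos a) (pos b) (pos d) ≠ 0 := by
  decide +kernel

lemma cross_pos_mul_pos : ∀ a b, InnerAdj a b → ∀ c d, InnerAdj c d →
    a ≠ c ∧ a ≠ d ∧ b ≠ c ∧ b ≠ d →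
    0 < cross (pos a) (pos b) (pos c) * cross (pos a) (pos b) (pos d) ∨
    0 < cross (pos c) (pos d) (pos a) * cross (pos c) (pos d) (pos b) := by
  decide +kernel

end Planar

end StarCol

namespace StarCol

open SimpleGraph

/-! ### The plane drawing of the whole chain -/

section Drawing

variable {n : ℕ}

/-- The points of the drawing of the chain: the copies are placed side by side. -/
def chainPoint (a : ZMod (n + 1) × GVertex 2) : ℝ × ℝ :=
  -- Each copy has width 14, so period 15 leaves a unit gap for the link.
  (15 * (a.1.val : ℝ) + ((pos a.2).1 : ℝ), ((pos a.2).2 : ℝ))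

/-- The segment joining the ends of an edge. -/
def chainSegment (e : Sym2 (ZMod (n + 1) × GVertex 2)) : Set (ℝ × ℝ) :=
  Sym2.lift ⟨fun a b => segment ℝ (chainPoint a) (chainPoint b), fun _ _ => segment_symm ℝ _ _⟩ e

lemma chainSegment_mk (a b : ZMod (n + 1) × GVertex 2) :
    chainSegment s(a, b) = segment ℝ (chainPoint a) (chainPoint b) := rfl

/-- The edge from the last copy to the first one. -/
def closingEdge (n : ℕ) : Sym2 (ZMod (n + 1) × GVertex 2) :=
  s((0, tailVertex 2), (-1, headVertex 2))

/-- The graph `G_4` chained up cyclically. -/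
abbrev chainGraph (n : ℕ) : SimpleGraph (ZMod (n + 1) × GVertex 2) :=
  cyclicChain (graphG 2) (headVertex 2) (tailVertex 2) (n + 1)

/-- The edges of the chain that are drawn as segments. -/
def IsStraight (e : Sym2 (ZMod (n + 1) × GVertex 2)) : Prop :=
  (∃ s a b, InnerAdj a b ∧ e = s((s, a), (s, b))) ∨
    -- The condition on values excludes the wrap-around link, at `s = -1`.
    ∃ s : ZMod (n + 1), (s + 1).val = s.val + 1 ∧ e = s((s, headVertex 2), (s + 1, tailVertex 2))

lemma pos_headVertex : pos (headVertex 2) = (14, 0) := by decide +kernel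

lemma pos_tailVertex : pos (tailVertex 2) = (0, 0) := by decide +kernel

lemma chainPoint_headVertex (s : ZMod (n + 1)) :
    chainPoint (s, headVertex 2) = (15 * (s.val : ℝ) + 14, 0) := by
  simp [chainPoint, pos_headVertex]

lemma chainPoint_tailVertex (s : ZMod (n + 1)) :
    chainPoint (s, tailVertex 2) = (15 * (s.val : ℝ), 0) := by
  simp [chainPoint, pos_tailVertex]

lemma chainPoint_bounds (s : ZMod (n + 1)) (u : GVertex 2) :
    15 * (s.val : ℝ) ≤ (chainPoint (s, u)).1 ∧ (chainPoint (s, u)).1 ≤ 15 * (s.val : ℝ) + 14 ∧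
      0 ≤ (chainPoint (s, u)).2 := by
  obtain ⟨h1, h2, h3, -⟩ := pos_bounds u
  have h1' : (0 : ℝ) ≤ (pos u).1 := by exact_mod_cast h1
  have h2' : ((pos u).1 : ℝ) ≤ 14 := by exact_mod_cast h2
  have h3' : (0 : ℝ) ≤ (pos u).2 := by exact_mod_cast h3
  simp only [chainPoint]
  exact ⟨by linarith, by linarith, h3'⟩

lemma eq_of_chainPoint_snd {s : ZMod (n + 1)} {u : GVertex 2} (h : (chainPoint (s, u)).2 = 0) :
    u = headVertex 2 ∨ u = tailVertex 2 :=
  (pos_bounds u).2.2.2 (by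
    simp only [chainPoint] at h
    exact_mod_cast h)

/-- Two blocks that overlap horizontally are the same. -/
lemma val_eq_of_overlap {s r : ZMod (n + 1)} {x : ℝ} (h1 : 15 * (s.val : ℝ) ≤ x)
    (h2 : x ≤ 15 * (s.val : ℝ) + 14) (h3 : 15 * (r.val : ℝ) ≤ x)
    (h4 : x ≤ 15 * (r.val : ℝ) + 14) : s = r := by
  have h5 : (15 * s.val : ℝ) ≤ 15 * r.val + 14 := by linarith
  have h6 : (15 * r.val : ℝ) ≤ 15 * s.val + 14 := by linarith
  norm_cast at h5 h6
  exact ZMod.val_injective _ (by lia)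

lemma chainPoint_injective : Function.Injective (chainPoint (n := n)) := by
  rintro ⟨s, u⟩ ⟨r, v⟩ h
  have h1 := chainPoint_bounds s u
  have h2 := chainPoint_bounds r v
  rw [← h] at h2
  obtain rfl := val_eq_of_overlap h1.1 h1.2.1 h2.1 h2.2.1
  have huv : pos u = pos v := by
    simp only [chainPoint, Prod.mk.injEq, add_right_inj, Int.cast_inj] at h
    exact Prod.ext h.1 h.2
  rw [pos_injective huv]

lemma cross_chainPoint (s : ZMod (n + 1)) (a b c : GVertex 2) :
    cross (chainPoint (s, a)) (chainPoint (s, b)) (chainPoint (s, c)) =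
      (cross (pos a) (pos b) (pos c) : ℤ) := by
  simp only [cross, chainPoint]
  push_cast
  ring

lemma bounds_of_mem_inner {s : ZMod (n + 1)} {a b : GVertex 2} {z : ℝ × ℝ}
    (hz : z ∈ chainSegment s((s, a), (s, b))) :
    15 * (s.val : ℝ) ≤ z.1 ∧ z.1 ≤ 15 * (s.val : ℝ) + 14 ∧ 0 ≤ z.2 := by
  rw [chainSegment_mk] at hz
  obtain ⟨p, q, hp, hq, hpq, rfl⟩ := exists_of_mem_segment hz
  obtain ⟨h1, h2, h3⟩ := chainPoint_bounds s a
  obtain ⟨h4, h5, h6⟩ := chainPoint_bounds s b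
  obtain rfl : p = 1 - q := by linarith
  refine ⟨?_, ?_, ?_⟩
  · dsimp only
    nlinarith
  · dsimp only
    nlinarith
  · dsimp only
    positivity

lemma bounds_of_mem_link {s : ZMod (n + 1)} {z : ℝ × ℝ} (hs : (s + 1).val = s.val + 1)
    (hz : z ∈ chainSegment s((s, headVertex 2), (s + 1, tailVertex 2))) :
    15 * (s.val : ℝ) + 14 ≤ z.1 ∧ z.1 ≤ 15 * (s.val : ℝ) + 15 ∧ z.2 = 0 := by
  rw [chainSegment_mk, chainPoint_headVertex, chainPoint_tailVertex, hs] at hz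
  obtain ⟨p, q, hp, hq, hpq, rfl⟩ := exists_of_mem_segment hz
  obtain rfl : p = 1 - q := by linarith
  push_cast
  refine ⟨?_, ?_, ?_⟩
  · nlinarith
  · nlinarith
  · simp

lemma IsStraight.snd_nonneg {e : Sym2 (ZMod (n + 1) × GVertex 2)} (he : IsStraight e)
    {z : ℝ × ℝ} (hz : z ∈ chainSegment e) : 0 ≤ z.2 := by
  rcases he with ⟨s, a, b, -, rfl⟩ | ⟨s, hs, rfl⟩
  · exact (bounds_of_mem_inner hz).2.2
  · exact (bounds_of_mem_link hs hz).2.2.ge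

lemma mem_link_of_chainPoint_mem {s : ZMod (n + 1)} (hs : (s + 1).val = s.val + 1)
    {x : ZMod (n + 1) × GVertex 2}
    (hx : chainPoint x ∈ chainSegment s((s, headVertex 2), (s + 1, tailVertex 2))) :
    x ∈ s((s, headVertex 2), (s + 1, tailVertex 2)) := by
  obtain ⟨r, u⟩ := x
  obtain ⟨h1, h2, h3⟩ := bounds_of_mem_link hs hx
  rw [Sym2.mem_iff]
  rcases eq_of_chainPoint_snd h3 with rfl | rfl
  · left
    rw [chainPoint_headVertex] at h1 h2
    dsimp only at h1 h2
    norm_cast at h1 h2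
    have : r = s := ZMod.val_injective _ (by lia)
    rw [this]
  · right
    rw [chainPoint_tailVertex] at h1 h2
    dsimp only at h1 h2
    norm_cast at h1 h2
    have : r = s + 1 := ZMod.val_injective _ (by lia)
    rw [this]

lemma IsStraight.mem_of_chainPoint_mem {e : Sym2 (ZMod (n + 1) × GVertex 2)} (he : IsStraight e)
    {x : ZMod (n + 1) × GVertex 2} (hx : chainPoint x ∈ chainSegment e) : x ∈ e := by
  rcases he with ⟨s, a, b, hab, rfl⟩ | ⟨s, hs, rfl⟩
  · obtain ⟨r, u⟩ := x
    obtain ⟨h1, h2, -⟩ := bounds_of_mem_inner hx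
    obtain ⟨h3, h4, -⟩ := chainPoint_bounds r u
    obtain rfl := val_eq_of_overlap h1 h2 h3 h4
    rw [Sym2.mem_iff]
    by_contra! h
    have h0 := cross_eq_zero_of_mem_segment hx
    rw [cross_chainPoint, Int.cast_eq_zero] at h0
    exact cross_pos_ne_zero a b hab u (fun h' => h.1 (by rw [h'])) (fun h' => h.2 (by rw [h'])) h0
  · exact mem_link_of_chainPoint_mem hs hx

/-- Heights are nonnegative and some end of a kept edge is strictly above the axis, so a convex
combination has height zero only at the other end. -/
lemma exists_eq_chainPoint_of_snd_eq_zero {s : ZMod (n + 1)} {a b : GVertex 2}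
    (hab : InnerAdj a b) {z : ℝ × ℝ} (hz : z ∈ chainSegment s((s, a), (s, b))) (hz2 : z.2 = 0) :
    ∃ x ∈ s((s, a), (s, b)), chainPoint x = z := by
  rw [chainSegment_mk] at hz
  obtain ⟨p, q, hp, hq, hpq, rfl⟩ := exists_of_mem_segment hz
  have ha := (chainPoint_bounds s a).2.2
  have hb := (chainPoint_bounds s b).2.2
  have hpa := mul_nonneg hp ha
  have hqb := mul_nonneg hq hb
  dsimp only at hz2
  rcases pos_pos_of_innerAdj a b hab with h | h
  · have h' : (chainPoint (s, a)).2 ≠ 0 := by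
      simp only [chainPoint]
      exact_mod_cast h.ne'
    obtain rfl : p = 0 := (mul_eq_zero.1 (by linarith)).resolve_right h'
    obtain rfl : q = 1 := by linarith
    exact ⟨(s, b), by simp, by simp⟩
  · have h' : (chainPoint (s, b)).2 ≠ 0 := by
      simp only [chainPoint]
      exact_mod_cast h.ne'
    obtain rfl : q = 0 := (mul_eq_zero.1 (by linarith)).resolve_right h'
    obtain rfl : p = 1 := by linarith
    exact ⟨(s, a), by simp, by simp⟩

lemma inner_inter_link {s r : ZMod (n + 1)} {a b : GVertex 2} (hab : InnerAdj a b)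
    (hr : (r + 1).val = r.val + 1) {z : ℝ × ℝ} (hz : z ∈ chainSegment s((s, a), (s, b)))
    (hz' : z ∈ chainSegment s((r, headVertex 2), (r + 1, tailVertex 2))) :
    ∃ x, x ∈ s((s, a), (s, b)) ∧ x ∈ s((r, headVertex 2), (r + 1, tailVertex 2)) ∧
      chainPoint x = z := by
  obtain ⟨x, hx, rfl⟩ :=
    exists_eq_chainPoint_of_snd_eq_zero hab hz (bounds_of_mem_link hr hz').2.2
  exact ⟨x, hx, mem_link_of_chainPoint_mem hr hz', rfl⟩

lemma InnerAdj.symm {a b : GVertex 2} (h : InnerAdj a b) : InnerAdj b a :=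
  ⟨h.1.symm, by rw [Sym2.eq_swap]; exact h.2⟩

lemma eq_chainPoint_of_mem_common {s : ZMod (n + 1)} {a b d : GVertex 2} (hab : InnerAdj a b)
    (had : InnerAdj a d) (hbd : b ≠ d) {z : ℝ × ℝ} (hz : z ∈ chainSegment s((s, a), (s, b)))
    (hz' : z ∈ chainSegment s((s, a), (s, d))) : z = chainPoint (s, a) := by
  refine eq_of_mem_segment_of_cross_ne_zero ?_ hz hz'
  rw [cross_chainPoint, Int.cast_ne_zero]
  exact cross_pos_ne_zero a b hab d had.1.ne' hbd.symm

lemma inner_inter_inner {s : ZMod (n + 1)} {a b c d : GVertex 2} (hab : InnerAdj a b)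
    (hcd : InnerAdj c d) (hne : s(a, b) ≠ s(c, d)) {z : ℝ × ℝ}
    (hz : z ∈ chainSegment s((s, a), (s, b))) (hz' : z ∈ chainSegment s((s, c), (s, d))) :
    ∃ x, x ∈ s((s, a), (s, b)) ∧ x ∈ s((s, c), (s, d)) ∧ chainPoint x = z := by
  rw [ne_eq, Sym2.eq_iff] at hne
  push Not at hne
  by_cases hac : a = c
  · subst hac
    exact ⟨(s, a), by simp, by simp, (eq_chainPoint_of_mem_common hab hcd (hne.1 rfl) hz hz').symm⟩
  by_cases had : a = d
  · subst had
    rw [Sym2.eq_swap (a := (s, c))] at hz' ⊢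
    exact ⟨(s, a), by simp, by simp,
      (eq_chainPoint_of_mem_common hab hcd.symm (hne.2 rfl) hz hz').symm⟩
  by_cases hbc : b = c
  · subst hbc
    rw [Sym2.eq_swap (a := (s, a))] at hz ⊢
    exact ⟨(s, b), by simp, by simp,
      (eq_chainPoint_of_mem_common hab.symm hcd had hz hz').symm⟩
  by_cases hbd : b = d
  · subst hbd
    rw [Sym2.eq_swap (a := (s, a))] at hz ⊢
    rw [Sym2.eq_swap (a := (s, c))] at hz' ⊢
    exact ⟨(s, b), by simp, by simp,
      (eq_chainPoint_of_mem_common hab.symm hcd.symm hac hz hz').symm⟩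
  rcases cross_pos_mul_pos a b hab c d hcd ⟨hac, had, hbc, hbd⟩ with h | h
  · refine absurd hz' (not_mem_segment_of_cross_mul_pos ?_ hz)
    rw [cross_chainPoint, cross_chainPoint]
    exact_mod_cast h
  · refine absurd hz (not_mem_segment_of_cross_mul_pos ?_ hz')
    rw [cross_chainPoint, cross_chainPoint]
    exact_mod_cast h

/-- Different copies occupy disjoint vertical strips, different links disjoint intervals of the
axis, and a kept edge reaches the axis only at a vertex. Edges of one copy are handled by the finite
checks on `pos`. -/
lemma IsStraight.inter {e e' : Sym2 (ZMod (n + 1) × GVertex 2)} (he : IsStraight e)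
    (he' : IsStraight e') (hne : e ≠ e') {z : ℝ × ℝ} (hz : z ∈ chainSegment e)
    (hz' : z ∈ chainSegment e') : ∃ x, x ∈ e ∧ x ∈ e' ∧ chainPoint x = z := by
  rcases he with ⟨s, a, b, hab, rfl⟩ | ⟨s, hs, rfl⟩ <;>
    rcases he' with ⟨r, c, d, hcd, rfl⟩ | ⟨r, hr, rfl⟩
  · obtain ⟨h1, h2, -⟩ := bounds_of_mem_inner hz
    obtain ⟨h3, h4, -⟩ := bounds_of_mem_inner hz'
    obtain rfl := val_eq_of_overlap h1 h2 h3 h4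
    refine inner_inter_inner hab hcd (fun h => hne ?_) hz hz'
    exact congrArg (Sym2.map (Prod.mk s)) h
  · exact inner_inter_link hab hr hz hz'
  · obtain ⟨x, h1, h2, h3⟩ := inner_inter_link hcd hs hz' hz
    exact ⟨x, h2, h1, h3⟩
  · obtain ⟨h1, h2, -⟩ := bounds_of_mem_link hs hz
    obtain ⟨h3, h4, -⟩ := bounds_of_mem_link hr hz'
    have h5 : (15 * s.val + 14 : ℝ) ≤ 15 * r.val + 15 := by linarith
    have h6 : (15 * r.val + 14 : ℝ) ≤ 15 * s.val + 15 := by linarith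
    norm_cast at h5 h6
    have : s = r := ZMod.val_injective _ (by lia)
    exact absurd (by rw [this]) hne

lemma isStraight_of_ne_closingEdge {e : Sym2 (ZMod (n + 1) × GVertex 2)}
    (he : e ∈ (chainGraph n).edgeSet) (hne : e ≠ closingEdge n) : IsStraight e := by
  have hlink : ∀ s : ZMod (n + 1),
      s((s, headVertex 2), (s + 1, tailVertex 2)) ≠ closingEdge n →
      (s + 1).val = s.val + 1 := by
    intro s hs
    by_cases h : s.val + 1 < n + 1
    · have hcast : s + 1 = ((s.val + 1 : ℕ) : ZMod (n + 1)) := by simp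
      rw [hcast, ZMod.val_natCast_of_lt h]
    · refine absurd ?_ hs
      have : s = -1 := ZMod.val_injective _ (by
        rw [ZMod.val_neg_one]
        have := ZMod.val_lt s
        lia)
      rw [this, closingEdge, neg_add_cancel, Sym2.eq_swap]
  induction e with | _ x y
  obtain ⟨s, a⟩ := x
  obtain ⟨r, b⟩ := y
  rw [mem_edgeSet, cyclicChain_adj (headVertex_adj_tailVertex (by lia)).ne] at he
  rcases he with ⟨h, h'⟩ | ⟨h, h1, h2⟩ | ⟨h, h1, h2⟩
  · obtain rfl : s = r := h
    exact Or.inl ⟨s, a, b, h', rfl⟩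
  · dsimp only at h h1 h2
    subst h h1 h2
    exact Or.inr ⟨s, hlink s hne, rfl⟩
  · dsimp only at h h1 h2
    subst h h1 h2
    rw [Sym2.eq_swap] at hne ⊢
    exact Or.inr ⟨r, hlink r hne, rfl⟩

lemma chainPoint_closing_zero : chainPoint ((0 : ZMod (n + 1)), tailVertex 2) = (0, 0) := by
  simp [chainPoint_tailVertex]

lemma chainPoint_closing_last :
    chainPoint ((-1 : ZMod (n + 1)), headVertex 2) = (15 * (n : ℝ) + 14, 0) := by
  rw [chainPoint_headVertex, ZMod.val_neg_one]

lemma exists_mem_closingEdge {z : ℝ × ℝ} (hz : z ∈ lowerArc (15 * (n : ℝ) + 14))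
    (hz2 : 0 ≤ z.2) : ∃ x ∈ closingEdge n, chainPoint x = z := by
  rcases eq_of_mem_lowerArc hz hz2 with rfl | rfl
  · exact ⟨_, Sym2.mem_mk_left _ _, chainPoint_closing_zero⟩
  · exact ⟨_, Sym2.mem_mk_right _ _, chainPoint_closing_last⟩

lemma IsStraight.inter_lowerArc {e : Sym2 (ZMod (n + 1) × GVertex 2)} (he : IsStraight e)
    {z : ℝ × ℝ} (hz : z ∈ chainSegment e) (hz' : z ∈ lowerArc (15 * (n : ℝ) + 14)) :
    ∃ x, x ∈ e ∧ x ∈ closingEdge n ∧ chainPoint x = z := by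
  obtain ⟨x, hx, rfl⟩ := exists_mem_closingEdge hz' (he.snd_nonneg hz)
  exact ⟨x, he.mem_of_chainPoint_mem hz, hx, rfl⟩

/-- All straight edges lie in the closed upper half-plane, whereas the closing arc is strictly below
the axis except at its ends. -/
lemma isPlanar_chainGraph (n : ℕ) : IsPlanar (chainGraph n) := by
  classical
  refine ⟨⟨chainPoint, chainPoint_injective,
    fun e => if e = closingEdge n then lowerArc (15 * (n : ℝ) + 14) else chainSegment e,
    ?_, ?_, ?_⟩⟩
  · intro x y hxy
    split_ifs with h
    · obtain ⟨γ, hγ, hγr⟩ := exists_path_range_eq_lowerArc (T := 15 * (n : ℝ) + 14) (by positivity)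
      rcases Sym2.eq_iff.1 h with ⟨rfl, rfl⟩ | ⟨rfl, rfl⟩
      · exact ⟨γ.cast chainPoint_closing_zero chainPoint_closing_last, hγ, hγr⟩
      · refine ⟨(γ.cast chainPoint_closing_zero chainPoint_closing_last).symm, ?_, ?_⟩
        · exact hγ.comp unitInterval.symm_bijective.injective
        · rw [Path.symm_range]
          exact hγr
    · exact exists_path_range_eq_segment (chainPoint_injective.ne hxy.ne)
  · intro e he x hx
    split_ifs at hx with h
    · obtain ⟨y, hy, hxy⟩ := exists_mem_closingEdge hx (chainPoint_bounds x.1 x.2).2.2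
      rw [h, ← chainPoint_injective hxy]
      exact hy
    · exact (isStraight_of_ne_closingEdge he h).mem_of_chainPoint_mem hx
  · rintro e he e' he' hne z ⟨hz, hz'⟩
    split_ifs at hz hz' with h h' h'
    · exact absurd (h.trans h'.symm) hne
    · obtain ⟨x, h1, h2, h3⟩ := (isStraight_of_ne_closingEdge he' h').inter_lowerArc hz' hz
      exact ⟨x, h ▸ h2, h1, h3⟩
    · obtain ⟨x, h1, h2, h3⟩ := (isStraight_of_ne_closingEdge he h).inter_lowerArc hz hz'
      exact ⟨x, h1, h' ▸ h2, h3⟩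
    · exact (isStraight_of_ne_closingEdge he h).inter (isStraight_of_ne_closingEdge he' h') hne
        hz hz'

lemma IsPlanar.of_iso {V W : Type*} {G : SimpleGraph V} {H : SimpleGraph W} (e : G ≃g H)
    (hH : IsPlanar H) : IsPlanar G := by
  obtain ⟨D⟩ := hH
  have hmap : ∀ d ∈ G.edgeSet, d.map e ∈ H.edgeSet := by
    intro d hd
    induction d with | _ x y
    exact e.map_adj_iff.2 hd
  have hmem : ∀ (d : Sym2 V) (x : V), e x ∈ d.map e → x ∈ d := by
    intro d x hx
    obtain ⟨y, hy, hxy⟩ := Sym2.mem_map.1 hx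
    rwa [← e.injective hxy]
  refine ⟨⟨fun x => D.point (e x), D.point_injective.comp e.injective, fun d => D.arc (d.map e),
    fun x y hxy => D.isArc _ _ (e.map_adj_iff.2 hxy),
    fun d hd x hx => hmem d x (D.vertex_mem _ (hmap d hd) _ hx), ?_⟩⟩
  intro d hd d' hd' hne z hz
  obtain ⟨x, h1, h2, h3⟩ := D.arc_inter _ (hmap d hd) _ (hmap d' hd')
    (fun h => hne (Sym2.map.injective e.injective h)) z hz
  obtain ⟨y, rfl⟩ := e.surjective x
  exact ⟨y, hmem d y h1, hmem d' y h2, h3⟩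

end Drawing

/-! ### Vertex count and assembly -/

lemma card_gVertex (p : ℕ) : Fintype.card (GVertex p) = (p + 1) * (p + 2) := by
  have h1 := Fintype.card_subtype_compl fun x : Fin (p + 2) × Fin (p + 2) => x.1 = x.2
  have h2 : Fintype.card {x : Fin (p + 2) × Fin (p + 2) // x.1 = x.2} = p + 2 := by
    rw [Fintype.card_congr (β := Fin (p + 2))
      ⟨fun x => x.1.1, fun i => ⟨(i, i), rfl⟩, fun x => Subtype.ext (Prod.ext rfl x.2),
        fun _ => rfl⟩, Fintype.card_fin]
  rw [h2, Fintype.card_prod, Fintype.card_fin] at h1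
  have h3 : (p + 2) * (p + 2) = (p + 1) * (p + 2) + (p + 2) := by ring
  rw [h3, Nat.add_sub_cancel] at h1
  rw [← h1]

end StarCol

theorem mainTheorem6 (p : ℕ) (hp : 2 ≤ p) (n : ℕ) (hn : 0 < n) (hdvd : (p + 1) * (p + 2) ∣ n) :
    ∃ (G : SimpleGraph (Fin n)) (_ : G.LocallyFinite),
      G.IsRegularOfDegree (2 * p) ∧
      G.IsHamiltonian ∧
      StarCol.StarColourable G (p + 2) ∧
      (∃ v w : StarCol.GVertex p, (StarCol.graphG p).Adj v w ∧
        ∃ e : G ≃g StarCol.cyclicChain (StarCol.graphG p) v w (n / ((p + 1) * (p + 2))),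
          StarCol.IsLocallyBijective G (StarCol.graphG p) (fun x => (e x).2)) ∧
      (p = 2 → StarCol.IsPlanar G) := by
  classical
  obtain ⟨t, ht⟩ := hdvd
  have hpos : 0 < (p + 1) * (p + 2) := by positivity
  have hdiv : n / ((p + 1) * (p + 2)) = t := by rw [ht, Nat.mul_div_cancel_left _ hpos]
  have ht0 : t ≠ 0 := by
    rintro rfl
    lia
  rw [hdiv]
  obtain ⟨m, rfl⟩ := Nat.exists_eq_succ_of_ne_zero ht0
  set H := StarCol.cyclicChain (StarCol.graphG p) (StarCol.headVertex p) (StarCol.tailVertex p)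
    (m + 1)
  have hvw := StarCol.headVertex_adj_tailVertex (p := p) (by lia)
  have hcard : Fintype.card (Fin n) = Fintype.card (ZMod (m + 1) × StarCol.GVertex p) := by
    rw [Fintype.card_fin, Fintype.card_prod, ZMod.card, StarCol.card_gVertex, ht, mul_comm]
  -- The chain is transported to `Fin n` by an arbitrary bijection; every property needed is
  -- invariant under isomorphism.
  let e : H.comap (Fintype.equivOfCardEq hcard) ≃g H :=
    SimpleGraph.Iso.comap (Fintype.equivOfCardEq hcard) H
  have hcover := (StarCol.isLocallyBijective_cyclicChain hvw (m + 1)).comp_iso e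
  obtain ⟨l, h1, h2, h3, h4, h5⟩ := StarCol.exists_hamiltonian_list hp
  have hlen : 3 ≤ l.length := by
    have := Finset.card_le_card (s := Finset.univ) (t := l.toFinset) fun x _ => by simp [h3]
    rw [Finset.card_univ, StarCol.card_gVertex, List.toFinset_card_of_nodup h2] at this
    nlinarith
  refine ⟨H.comap (Fintype.equivOfCardEq hcard), fun _ => Fintype.ofFinite _, ?_, ?_,
    StarCol.starColourable_of_isLocallyBijective hcover, ⟨_, _, hvw, e, hcover⟩, ?_⟩
  · intro x
    convert (hcover.degree_eq x).trans (StarCol.graphG_degree p _)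
  · exact StarCol.isHamiltonian_of_iso e.symm
      (StarCol.isHamiltonian_cyclicChain hvw h1 h2 h3 h4 h5 hlen (m + 1))
  · rintro rfl
    exact (StarCol.isPlanar_chainGraph m).of_iso e
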